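/- Let $r,n\ge 1$ be integers, let $q$ be an indeterminate and put $\mathcal R=\mathbb Z[\tfrac1r][q,q^{-1}]$. The affine Yokonuma-Hecke algebra $\widehat Y_{r,n}(q)$ is the associative unital $\mathcal R$-algebra generated by $t_1,\dots,t_n,\ g_1,\dots,g_{n-1},\ X_1^{\pm1}$ subject to the relations - $g_ig_j=g_jg_i$ for $|i-j|\ge2$, and $g_ig_{i+1}g_i=g_{i+1}g_ig_{i+1}$ for $1\le i\le n-2$; - $t_it_j=t_jt_i$ and $t_j^r=1$ for $1\le i,j\le n$; - $g_it_j=t_{s_i(j)}g_i$ for $1\le i\le n-1$, $1\le j\le n$, where $s_i$ is the transposition $(i,i+1)$; - $g_i^2=1+(q-q^{-1})e_ig_i$ for $1\le i\le n-1$, where $e_i=\frac1r\sum_{s=0}^{r-1}t_i^st_{i+1}^{-s}$; - $X_1X_1^{-1}=X_1^{-1}X_1=1$, $\ g_1X_1g_1X_1=X_1g_1X_1g_1$ (if $n\ge2$), $\ g_iX_1=X_1g_i$ for $2\le i\le n-1$, and $t_jX_1=X_1t_j$ for $1\le j\le n$. Let $\mathbb K$ be an algebraically closed field of characteristic $p\ge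 0$ such that $p$ does not divide $r$, regarded as an $\mathcal R$-algebra by sending the indeterminate $q$ to an element of $\mathbb K^*$, and let $\widehat Y_{r,n}^{\mathbb K}=\mathbb K\otimes_{\mathcal R}\widehat Y_{r,n}(q)$. Then every irreducible $\widehat Y_{r,n}^{\mathbb K}$-module $M$ is finite dimensional over $\mathbb K$. -/

import Mathlib

open scoped TensorProduct

namespace AffineYokonumaHecke

/-- The ground ring `ℤ[1/r][q, q⁻¹]`, with `q` an indeterminate. -/
def BaseRing (r : ℕ) : Type :=
  LaurentPolynomial (Localization.Away (r : ℤ))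

noncomputable instance (r : ℕ) : CommRing (BaseRing r) :=
  inferInstanceAs (CommRing (LaurentPolynomial (Localization.Away (r : ℤ))))

/-- The indeterminate `q` of the ground ring. -/
noncomputable def q (r : ℕ) : BaseRing r :=
  (LaurentPolynomial.T 1 : LaurentPolynomial (Localization.Away (r : ℤ)))

/-- The inverse `q⁻¹` of the indeterminate. -/
noncomputable def qInv (r : ℕ) : BaseRing r :=
  (LaurentPolynomial.T (-1) : LaurentPolynomial (Localization.Away (r : ℤ)))

/-- The element `1/r` of the ground ring. -/
noncomputable def rInv (r : ℕ) : BaseRing r :=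
  LaurentPolynomial.C (IsLocalization.Away.invSelf (r : ℤ))

/-- The generators `t₁, …, tₙ`, `g₁, …, gₙ₋₁`, `X₁`, `X₁⁻¹`. Indices are shifted by one, so they
start from `0`. -/
inductive Gen (n : ℕ) : Type
  | t (j : Fin n) : Gen n
  | g (i : Fin (n - 1)) : Gen n
  | X : Gen n
  | Xinv : Gen n

/-- The free associative algebra on the generators. -/
abbrev Free (r n : ℕ) : Type := FreeAlgebra (BaseRing r) (Gen n)

section FreeElements

variable (r : ℕ) {n : ℕ}

/-- The generator `t j`. -/
noncomputable def t (j : Fin n) : Free r n := FreeAlgebra.ι (BaseRing r) (Gen.t j)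

/-- The generator `g i`. -/
noncomputable def g (i : Fin (n - 1)) : Free r n := FreeAlgebra.ι (BaseRing r) (Gen.g i)

/-- The generator `X₁`. -/
noncomputable def X (n : ℕ) : Free r n := FreeAlgebra.ι (BaseRing r) Gen.X

/-- The generator `X₁⁻¹`. -/
noncomputable def Xinv (n : ℕ) : Free r n := FreeAlgebra.ι (BaseRing r) Gen.Xinv

/-- The index `i` of `g i`, as one of the `n` letters. -/
def lo (i : Fin (n - 1)) : Fin n := ⟨i.val, by omega⟩

/-- The index `i + 1`, as one of the `n` letters. -/
def hi (i : Fin (n - 1)) : Fin n := ⟨i.val + 1, by omega⟩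

/-- The element `e i = (1/r) ∑_{s=0}^{r-1} (t i)^s (t (i+1))^{-s}`. Since `(t (i+1))^r = 1` is
imposed, `(t (i+1))^{-s}` is written as `(t (i+1))^{r-s}`. -/
noncomputable def e (i : Fin (n - 1)) : Free r n :=
  rInv r • ∑ s ∈ Finset.range r, t r (lo i) ^ s * t r (hi i) ^ (r - s)

end FreeElements

/-- The defining relations of the affine Yokonuma-Hecke algebra. -/
inductive Rel (r n : ℕ) : Free r n → Free r n → Prop
  | g_comm (i j : Fin (n - 1)) (h : 2 ≤ |(i.val : ℤ) - (j.val : ℤ)|) :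
      Rel r n (g r i * g r j) (g r j * g r i)
  | g_braid (i j : Fin (n - 1)) (h : j.val = i.val + 1) :
      Rel r n (g r i * g r j * g r i) (g r j * g r i * g r j)
  | t_comm (i j : Fin n) : Rel r n (t r i * t r j) (t r j * t r i)
  | g_t (i : Fin (n - 1)) (j : Fin n) :
      Rel r n (g r i * t r j) (t r (Equiv.swap (lo i) (hi i) j) * g r i)
  | t_pow (j : Fin n) : Rel r n (t r j ^ r) 1
  | g_sq (i : Fin (n - 1)) :
      Rel r n (g r i ^ 2) (1 + (q r - qInv r) • (e r i * g r i))
  | X_Xinv : Rel r n (X r n * Xinv r n) 1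
  | Xinv_X : Rel r n (Xinv r n * X r n) 1
  | g_X_g_X (i : Fin (n - 1)) (h : i.val = 0) :
      Rel r n (g r i * X r n * g r i * X r n) (X r n * g r i * X r n * g r i)
  | g_X (i : Fin (n - 1)) (h : i.val ≠ 0) : Rel r n (g r i * X r n) (X r n * g r i)
  | t_X (j : Fin n) : Rel r n (t r j * X r n) (X r n * t r j)

end AffineYokonumaHecke

open AffineYokonumaHecke in
/-- The generic affine Yokonuma-Hecke algebra `Ŷ_{r,n}(q)` over `ℤ[1/r][q, q⁻¹]`, given by
generators and relations. -/
abbrev AffineYokonumaHeckeAlgebra (r n : ℕ) : Type := RingQuot (Rel r n)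

/-- The specialization `𝕂 ⊗ Ŷ_{r,n}(q)` over `ℤ[1/r][q, q⁻¹]`, for an algebra `𝕂` over that
ring. -/
abbrev SpecializedAffineYokonumaHecke (r n : ℕ) (𝕂 : Type*) [Field 𝕂]
    [Algebra (AffineYokonumaHecke.BaseRing r) 𝕂] : Type _ :=
  𝕂 ⊗[AffineYokonumaHecke.BaseRing r] AffineYokonumaHeckeAlgebra r n

/-! Let `P` be the subalgebra generated by the `t j`, the Jucys-Murphy elements `X (i+1) = g i * X i
* g i` and their inverses. It is commutative and of finite type. Moving each `g i` rightwards past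
`P` costs only a term in `P` (`exists_g_mul_eq_add`), and words in the `g i` reduce to a finite set
`F` of normal forms with coefficients in the `t j` (`g_mul_mem`), so the whole algebra `A` is `P *
F` (`leftSpan_words_eq_top`).

A simple `M` is cyclic over `A`, hence finitely generated over `P`, and has a maximal `P`-submodule
`N`. The Nullstellensatz makes `M ⧸ N` finite dimensional. If `f • m ∈ N` for all `f ∈ F`, then `A •
m ⊆ N`, so `m = 0` by simplicity. Thus `m ↦ (f • m)` embeds `M` into a finite power of `M ⧸ N`. The
center of `A` plays no role. -/

/-! ### Finiteness criterion for simple modules. -/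

/-- A simple module over an algebra which is finitely spanned, as a left module, over a commutative
algebra of finite type is finite dimensional. -/
theorem finiteDimensional_of_isSimpleModule_of_span {K A P M : Type*} [Field K] [Ring A]
    [Algebra K A] [CommRing P] [Algebra K P] [Algebra.FiniteType K P] (φ : P →ₐ[K] A)
    {F : Set A} (hF : F.Finite)
    (hspan : ∀ S : AddSubgroup A, (∀ (x : P), ∀ f ∈ F, φ x * f ∈ S) → S = ⊤)
    [AddCommGroup M] [Module A M] [Module K M] [IsScalarTower K A M] [IsSimpleModule A M] :
    FiniteDimensional K M := by
  let _ : Module P M := Module.compHom M φ.toRingHom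
  have smul_def : ∀ (x : P) (m : M), x • m = φ x • m := fun _ _ => rfl
  have : IsScalarTower K P M := ⟨fun k x m => by
    rw [smul_def, smul_def, map_smul, smul_assoc]⟩
  have : Nontrivial M := IsSimpleModule.nontrivial A M
  have : Module.Finite P M := by
    obtain ⟨m, hm⟩ := exists_ne (0 : M)
    refine ⟨Submodule.fg_def.2 ⟨(fun a : A => a • m) '' F, hF.image _, ?_⟩⟩
    rw [eq_top_iff]
    rintro z -
    obtain ⟨a, rfl⟩ := IsSimpleModule.toSpanSingleton_surjective A hm z
    let S : AddSubgroup A := (Submodule.span P ((fun a : A => a • m) '' F)).toAddSubgroup.comap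
      (LinearMap.toSpanSingleton A M m).toAddMonoidHom
    have hS : S = ⊤ := hspan S fun x f hf => by
      change (φ x * f) • m ∈ Submodule.span P ((fun a : A => a • m) '' F)
      rw [mul_smul, ← smul_def]
      exact Submodule.smul_mem _ _ (Submodule.subset_span ⟨f, hf, rfl⟩)
    exact (hS ▸ AddSubgroup.mem_top a : a ∈ S)
  -- Finite generation over `P` is what guarantees a maximal proper submodule.
  obtain ⟨N, hN⟩ : ∃ N : Submodule P M, IsCoatom N := by
    obtain h | ⟨N, hN, -⟩ := eq_top_or_exists_le_coatom (⊥ : Submodule P M)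
    · exact absurd h bot_ne_top
    · exact ⟨N, hN⟩
  have : IsSimpleModule P (M ⧸ N) := isSimpleModule_iff_isCoatom.2 hN
  -- The quotient is `P ⧸ I` with `I` maximal, so Zariski's lemma applies.
  have : FiniteDimensional K (M ⧸ N) := by
    obtain ⟨I, hI, ⟨ψ⟩⟩ := (isSimpleModule_iff_quot_maximal (R := P)).1 this
    let _ := Ideal.Quotient.field I
    have : Module.Finite K (P ⧸ I) := finite_of_finite_type_of_isJacobsonRing K (P ⧸ I)
    exact Module.Finite.equiv (ψ.restrictScalars K).symm
  have : Finite F := hF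
  have hcomm : ∀ (a : A) (k : K) (m : M), a • k • m = k • a • m := fun a k m => by
    rw [← algebraMap_smul A k m, ← algebraMap_smul A k (a • m), ← mul_smul, ← mul_smul,
      Algebra.commutes]
  let Φ : M →ₗ[K] (F → M ⧸ N) :=
    { toFun := fun m f => N.mkQ ((f : A) • m)
      map_add' := fun m m' => by ext f; simp
      map_smul' := fun k m => by
        ext f
        simp only [hcomm, RingHom.id_apply, Pi.smul_apply]
        rfl }
  -- The largest `A`-submodule contained in `N`; it is proper because `N` is.
  let L : Submodule A M :=
    { carrier := {m | ∀ a : A, a • m ∈ N}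
      add_mem' := fun h h' a => by rw [smul_add]; exact N.add_mem (h a) (h' a)
      zero_mem' := fun a => by rw [smul_zero]; exact N.zero_mem
      smul_mem' := fun b m h a => by rw [← mul_smul]; exact h _ }
  have hL : L = ⊥ := by
    refine (eq_bot_or_eq_top L).resolve_right fun h => hN.1 ?_
    rw [eq_top_iff]
    rintro m -
    have : m ∈ L := h ▸ Submodule.mem_top
    simpa using this 1
  refine FiniteDimensional.of_injective Φ ?_
  rw [injective_iff_map_eq_zero]
  intro m hm
  have hmF : ∀ f ∈ F, f • m ∈ N := fun f hf =>
    (Submodule.Quotient.mk_eq_zero N).1 (congrFun hm ⟨f, hf⟩)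
  have hmL : m ∈ L := by
    let S : AddSubgroup A := N.toAddSubgroup.comap (LinearMap.toSpanSingleton A M m).toAddMonoidHom
    have hS : S = ⊤ := hspan S fun x f hf => by
      change (φ x * f) • m ∈ N
      rw [mul_smul, ← smul_def]
      exact N.smul_mem _ (hmF f hf)
    exact fun a => (hS ▸ AddSubgroup.mem_top a : a ∈ S)
  rwa [hL, Submodule.mem_bot] at hmL

/-! ### Abstract relations and normal form words. -/

namespace AffineYokonumaHecke

/-- Elements of an algebra satisfying relations of affine Yokonuma-Hecke type, where only the
properties of the quadratic relation that are relevant for spanning sets are recorded. -/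
structure System (K : Type*) {A ι : Type*} [Field K] [Ring A] [Algebra K A] (n : ℕ)
    (t : ι → A) (g e : ℕ → A) (X Xinv : A) : Prop where
  g_comm : ∀ i j, i + 2 ≤ j → j + 1 < n → Commute (g i) (g j)
  braid : ∀ i, i + 2 < n → g i * g (i + 1) * g i = g (i + 1) * g i * g (i + 1)
  t_comm : ∀ i j, Commute (t i) (t j)
  g_t : ∀ i j, i + 1 < n → ∃ k, g i * t j = t k * g i ∧ g i * t k = t j * g i
  e_mem : ∀ i, i + 1 < n → e i ∈ Algebra.adjoin K (Set.range t)
  g_sq : ∀ i, i + 1 < n → g i * g i = 1 + e i * g i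
  g_e : ∀ i, i + 1 < n → g i * e i = e i * g i
  X_Xinv : X * Xinv = 1
  Xinv_X : Xinv * X = 1
  g_X_g_X : 1 < n → g 0 * X * g 0 * X = X * g 0 * X * g 0
  g_X : ∀ i, 1 ≤ i → i + 1 < n → Commute (g i) X
  t_X : ∀ j, Commute (t j) X

section Words

variable {A : Type*} [Ring A]

/-- The Jucys-Murphy type elements `X (i+1) = g i * X i * g i`. -/
def jm (g : ℕ → A) (X : A) : ℕ → A
  | 0 => X
  | i + 1 => g i * jm g X i * g i

/-- The product `g k * g (k+1) * ⋯ * g (k+d-1)`. -/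
def seg (g : ℕ → A) : ℕ → ℕ → A
  | _, 0 => 1
  | k, d + 1 => g k * seg g (k + 1) d

/-- The normal form words in `g 0, …, g (m-2)`. -/
def words (g : ℕ → A) : ℕ → Set A
  | 0 => {1}
  | m + 1 => ⋃ k ∈ Set.Iic m, (fun f => seg g k (m - k) * f) '' words g m

theorem finite_words (g : ℕ → A) (m : ℕ) : (words g m).Finite := by
  induction m with
  | zero => exact Set.finite_singleton _
  | succ m ih => exact (Set.finite_Iic m).biUnion fun k _ => ih.image _

theorem one_mem_words (g : ℕ → A) (m : ℕ) : (1 : A) ∈ words g m := by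
  induction m with
  | zero => exact rfl
  | succ m ih =>
    exact Set.mem_biUnion (x := m) (Set.mem_Iic.2 le_rfl) ⟨1, ih, by simp [seg]⟩

/-- The additive span of the products `x * f` with `x ∈ T` and `f ∈ F`. -/
def leftSpan (T F : Set A) : AddSubgroup A :=
  AddSubgroup.closure {a | ∃ x ∈ T, ∃ f ∈ F, a = x * f}

theorem mul_mem_leftSpan {T F : Set A} {x f : A} (hx : x ∈ T) (hf : f ∈ F) :
    x * f ∈ leftSpan T F :=
  AddSubgroup.subset_closure ⟨x, hx, f, hf, rfl⟩

theorem mul_mem_of_mem_leftSpan {T F : Set A} {S : AddSubgroup A} {b : A}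
    (h : ∀ x ∈ T, ∀ f ∈ F, b * (x * f) ∈ S) {a : A} (ha : a ∈ leftSpan T F) : b * a ∈ S := by
  have : leftSpan T F ≤ S.comap (AddMonoidHom.mulLeft b) := by
    rw [leftSpan, AddSubgroup.closure_le]
    rintro _ ⟨x, hx, f, hf, rfl⟩
    exact h x hx f hf
  exact this ha

end Words

theorem commute_of_inverse {A : Type*} [Ring A] {a x y : A} (h : Commute a x) (hxy : x * y = 1)
    (hyx : y * x = 1) : Commute a y := by
  let u : Aˣ := ⟨x, y, hxy, hyx⟩
  exact Commute.units_inv_right (u := u) h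

/-! ### Reduction of words in the `g i` over the `t j`. -/

namespace System

variable {K A ι : Type*} [Field K] [Ring A] [Algebra K A] {n : ℕ}
    {t : ι → A} {g e : ℕ → A} {X Xinv : A}

theorem g_mul_inv (s : System K n t g e X Xinv) {i : ℕ} (hi : i + 1 < n) :
    g i * (g i - e i) = 1 := by
  rw [mul_sub, s.g_sq i hi, s.g_e i hi, add_sub_cancel_right]

theorem inv_mul_g (s : System K n t g e X Xinv) {i : ℕ} (hi : i + 1 < n) :
    (g i - e i) * g i = 1 := by
  rw [sub_mul, s.g_sq i hi, add_sub_cancel_right]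

theorem g_comm' (s : System K n t g e X Xinv) {i j : ℕ} (hi : i + 1 < n) (hj : j + 1 < n)
    (h : i + 2 ≤ j ∨ j + 2 ≤ i) : Commute (g i) (g j) :=
  h.elim (fun h => s.g_comm i j h hj) fun h => (s.g_comm j i h hi).symm

theorem commute_seg (s : System K n t g e X Xinv) {j : ℕ} (d : ℕ) : ∀ {k : ℕ}, j + 2 ≤ k →
    k + d < n → Commute (g j) (seg g k d) := by
  induction d with
  | zero => exact fun _ _ => Commute.one_right _
  | succ d ih =>
    intro k hk hd
    exact (s.g_comm j k hk (by omega)).mul_right (ih (by omega) (by omega))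

/-- `g (j+1)` commutes past the letters before `g j`, the braid relation turns `g (j+1) * g j * g
(j+1)` into `g j * g (j+1) * g j`, and the last `g j` commutes with the remaining letters. -/
theorem g_mul_seg (s : System K n t g e X Xinv) {j : ℕ} (d : ℕ) : ∀ {k : ℕ}, k ≤ j →
    j + 1 < k + d → k + d < n → g (j + 1) * seg g k d = seg g k d * g j := by
  induction d with
  | zero => intro k h1 h2; omega
  | succ d ih =>
    intro k h1 h2 h3
    rcases h1.eq_or_lt with rfl | h1
    · obtain ⟨d, rfl⟩ : ∃ d', d = d' + 1 := ⟨d - 1, by omega⟩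
      have hc : g k * seg g (k + 1 + 1) d = seg g (k + 1 + 1) d * g k :=
        s.commute_seg d (by omega) (by omega)
      simp only [seg]
      rw [← mul_assoc, ← mul_assoc, ← s.braid k (by omega)]
      simp only [mul_assoc]
      rw [hc]
    · have hc : g (j + 1) * g k = g k * g (j + 1) := (s.g_comm k (j + 1) (by omega) (by omega)).symm
      simp only [seg]
      rw [← mul_assoc, hc, mul_assoc, ih (by omega) (by omega) (by omega), mul_assoc]

theorem exists_g_mul (s : System K n t g e X Xinv) {i : ℕ} (hi : i + 1 < n) {x : A}
    (hx : x ∈ Algebra.adjoin K (Set.range t)) :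
    ∃ y ∈ Algebra.adjoin K (Set.range t), g i * x = y * g i := by
  induction hx using Algebra.adjoin_induction with
  | mem x hx =>
    obtain ⟨j, rfl⟩ := hx
    obtain ⟨k, hk, -⟩ := s.g_t i j hi
    exact ⟨_, Algebra.subset_adjoin ⟨k, rfl⟩, hk⟩
  | algebraMap r => exact ⟨_, Subalgebra.algebraMap_mem _ r, (Algebra.commutes r (g i)).symm⟩
  | add x y _ _ hx hy =>
    obtain ⟨a, ha, hx⟩ := hx
    obtain ⟨b, hb, hy⟩ := hy
    exact ⟨a + b, add_mem ha hb, by rw [mul_add, add_mul, hx, hy]⟩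
  | mul x y _ _ hx hy =>
    obtain ⟨a, ha, hx⟩ := hx
    obtain ⟨b, hb, hy⟩ := hy
    exact ⟨a * b, mul_mem ha hb, by rw [← mul_assoc, hx, mul_assoc, hy, mul_assoc]⟩

theorem exists_seg_mul (s : System K n t g e X Xinv) {x : A}
    (hx : x ∈ Algebra.adjoin K (Set.range t)) (d : ℕ) : ∀ {k : ℕ}, k + d < n →
    ∃ y ∈ Algebra.adjoin K (Set.range t), seg g k d * x = y * seg g k d := by
  induction d with
  | zero => exact fun _ => ⟨x, hx, by simp [seg]⟩
  | succ d ih =>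
    intro k hk
    obtain ⟨y, hy, h⟩ := ih (k := k + 1) (by omega)
    obtain ⟨z, hz, h'⟩ := s.exists_g_mul (i := k) (by omega) hy
    exact ⟨z, hz, by rw [seg, mul_assoc, h, ← mul_assoc, h', mul_assoc]⟩

theorem seg_mul_mem (s : System K n t g e X Xinv) {m k : ℕ} (hm : m < n) (hk : k ≤ m) {u : A}
    (hu : u ∈ leftSpan (Algebra.adjoin K (Set.range t) : Set A) (words g m)) :
    seg g k (m - k) * u ∈
      leftSpan (Algebra.adjoin K (Set.range t) : Set A) (words g (m + 1)) := by
  refine mul_mem_of_mem_leftSpan (fun x hx f hf => ?_) hu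
  obtain ⟨y, hy, h⟩ := s.exists_seg_mul hx (m - k) (k := k) (by omega)
  rw [← mul_assoc, h, mul_assoc]
  exact mul_mem_leftSpan hy (Set.mem_biUnion (x := k) hk ⟨f, hf, rfl⟩)

/-- The span of the normal form words over the `t j` is stable under left multiplication by the
`g j`. -/
theorem g_mul_mem (s : System K n t g e X Xinv) {m : ℕ} : ∀ {j : ℕ}, m ≤ n → j + 1 < m → ∀ {u : A},
    u ∈ leftSpan (Algebra.adjoin K (Set.range t) : Set A) (words g m) →
    g j * u ∈ leftSpan (Algebra.adjoin K (Set.range t) : Set A) (words g m) := by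
  induction m with
  | zero => intro j _ h; omega
  | succ m ih =>
    intro j hm hj u hu
    refine mul_mem_of_mem_leftSpan (fun x hx f hf => ?_) hu
    obtain ⟨y, hy, h⟩ := s.exists_g_mul (i := j) (by omega) hx
    rw [← mul_assoc, h, mul_assoc]
    suffices H : g j * f ∈
        leftSpan (Algebra.adjoin K (Set.range t) : Set A) (words g (m + 1)) from
      mul_mem_of_mem_leftSpan (fun z hz f' hf' => by
        rw [← mul_assoc]; exact mul_mem_leftSpan (mul_mem hy hz) hf') H
    simp only [words, Set.mem_iUnion, Set.mem_image] at hf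
    obtain ⟨k, hk, f, hf, rfl⟩ := hf
    rw [Set.mem_Iic] at hk
    have hf' : f ∈ leftSpan (Algebra.adjoin K (Set.range t) : Set A) (words g m) := by
      simpa using mul_mem_leftSpan (one_mem (Algebra.adjoin K (Set.range t))) hf
    -- The segments `g k * ⋯ * g (m-1)` play the role of coset representatives of `S_m` in
    -- `S_{m+1}`. Left multiplication by `g j` lengthens the segment (`j + 1 = k`), passes through
    -- it as `g j` (`j + 1 < k`) or as `g (j-1)` (`j > k`), or meets the same letter and is reduced
    -- by the quadratic relation (`j = k`).
    rcases lt_trichotomy j k with hjk | rfl | hjk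
    · rcases (show j + 1 ≤ k from hjk).eq_or_lt with rfl | hjk
      · have := s.seg_mul_mem (k := j) (by omega) (by omega) hf'
        rw [show m - j = m - (j + 1) + 1 by omega, seg, mul_assoc] at this
        exact this
      · rw [← mul_assoc, (s.commute_seg (m - k) (by omega) (by omega)).eq, mul_assoc]
        exact s.seg_mul_mem (by omega) hk (ih (by omega) (by omega) hf')
    · have h1 := s.seg_mul_mem (k := j + 1) (by omega) (by omega) hf'
      have h2 : e j * (seg g j (m - j) * f) ∈
          leftSpan (Algebra.adjoin K (Set.range t) : Set A) (words g (m + 1)) :=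
        mul_mem_leftSpan (s.e_mem j (by omega)) (Set.mem_biUnion (x := j) hk ⟨f, hf, rfl⟩)
      have h3 := add_mem h1 h2
      rw [show m - j = m - (j + 1) + 1 by omega, seg] at h3 ⊢
      convert h3 using 1
      have := s.g_sq j (by omega)
      rw [mul_assoc (g j), ← mul_assoc (g j) (g j), this, add_mul, one_mul]
      simp only [mul_assoc]
    · obtain ⟨j, rfl⟩ : ∃ j', j = j' + 1 := ⟨j - 1, by omega⟩
      rw [← mul_assoc, s.g_mul_seg (m - k) (by omega) (by omega) (by omega), mul_assoc]
      exact s.seg_mul_mem (by omega) hk (ih (by omega) (by omega) hf')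

/-! ### Commutation and inversion of the Jucys-Murphy elements. -/

theorem g_jm (s : System K n t g e X Xinv) (i : ℕ) : ∀ {j : ℕ}, i < n → j + 1 < n →
    i ≠ j → i ≠ j + 1 → Commute (g j) (jm g X i) := by
  induction i using Nat.strong_induction_on with
  | _ i ih =>
    intro j hi hj h1 h2
    cases i with
    | zero => exact s.g_X j (by omega) hj
    | succ i =>
      -- The only case with interaction: in `g (j+1) * g j * X j * g j * g (j+1)` the braid relation
      -- is used once on each side of `X j`, with `g (j+1)` crossing `X j` in between.
      by_cases h : i = j + 1
      · subst h
        have hx : Commute (g (j + 1)) (jm g X j) :=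
          ih j (by omega) (by omega) (by omega) (by omega) (by omega)
        have hb := s.braid j (by omega)
        change g j * (g (j + 1) * (g j * jm g X j * g j) * g (j + 1)) =
          g (j + 1) * (g j * jm g X j * g j) * g (j + 1) * g j
        calc g j * (g (j + 1) * (g j * jm g X j * g j) * g (j + 1))
            = (g j * g (j + 1) * g j) * jm g X j * (g j * g (j + 1)) := by noncomm_ring
          _ = g (j + 1) * g j * (g (j + 1) * jm g X j) * (g j * g (j + 1)) := by
              rw [hb]; noncomm_ring
          _ = g (j + 1) * g j * jm g X j * (g (j + 1) * g j * g (j + 1)) := by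
              rw [hx.eq]; noncomm_ring
          _ = _ := by rw [← hb]; noncomm_ring
      · have hg : Commute (g j) (g i) := s.g_comm' hj hi (by omega)
        have hx : Commute (g j) (jm g X i) :=
          ih i (by omega) (by omega) hj (by omega) (by omega)
        exact (hg.mul_right hx).mul_right hg

theorem jm_comm_of_lt (s : System K n t g e X Xinv) (i : ℕ) : ∀ {j : ℕ}, i < j → j < n →
    Commute (jm g X i) (jm g X j) := by
  induction i with
  | zero =>
    intro j hj hn
    induction j with
    | zero => omega
    | succ j ih =>
      by_cases h : j = 0
      · subst h
        have := s.g_X_g_X hn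
        simp only [mul_assoc] at this
        simpa only [jm, mul_assoc, Commute, SemiconjBy] using this.symm
      · have hg : Commute X (g j) := (s.g_X j (by omega) hn).symm
        exact (hg.mul_right (ih (by omega) (by omega))).mul_right hg
  | succ i ih =>
    intro j hj hn
    have hg : Commute (g i) (jm g X j) := s.g_jm j hn (by omega) (by omega) (by omega)
    exact (hg.mul_left (ih (by omega) hn)).mul_left hg

theorem jm_comm (s : System K n t g e X Xinv) {i j : ℕ} (hi : i < n) (hj : j < n) :
    Commute (jm g X i) (jm g X j) := by
  rcases lt_trichotomy i j with h | rfl | h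
  · exact s.jm_comm_of_lt i h hj
  · exact Commute.refl _
  · exact (s.jm_comm_of_lt j h hi).symm

/-- Crossing the two factors `g i` permutes the index of `t` twice by the same transposition; the
second half of `g_t` records that this is an involution. -/
theorem t_jm (s : System K n t g e X Xinv) (i : ℕ) : ∀ (j : ι), i < n →
    Commute (t j) (jm g X i) := by
  induction i with
  | zero => exact fun j _ => s.t_X j
  | succ i ih =>
    intro j hi
    obtain ⟨k, h1, h2⟩ := s.g_t i j hi
    change t j * (g i * jm g X i * g i) = g i * jm g X i * g i * t j
    rw [mul_assoc _ _ (t j), h1, ← mul_assoc, ← mul_assoc, ← h2, mul_assoc (g i),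
      (ih k (by omega)).eq]
    simp only [mul_assoc]

/-- Since `g i` has inverse `g i - e i` and the recursion is palindromic, the same recursion run
with the inverses produces the inverse. -/
theorem jm_mul_inv (s : System K n t g e X Xinv) {i : ℕ} (hi : i < n) :
    jm g X i * jm (g - e) Xinv i = 1 := by
  induction i with
  | zero => exact s.X_Xinv
  | succ i ih =>
    simp only [jm, Pi.sub_apply]
    calc _ = g i * jm g X i * (g i * (g i - e i)) * jm (g - e) Xinv i * (g i - e i) := by
            simp only [mul_assoc]
      _ = g i * (jm g X i * jm (g - e) Xinv i) * (g i - e i) := by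
            rw [s.g_mul_inv hi]; simp only [mul_assoc, one_mul]
      _ = 1 := by rw [ih (by omega), mul_one, s.g_mul_inv hi]

theorem inv_mul_jm (s : System K n t g e X Xinv) {i : ℕ} (hi : i < n) :
    jm (g - e) Xinv i * jm g X i = 1 := by
  induction i with
  | zero => exact s.Xinv_X
  | succ i ih =>
    simp only [jm, Pi.sub_apply]
    calc _ = (g i - e i) * jm (g - e) Xinv i * ((g i - e i) * g i) * jm g X i * g i := by
            simp only [mul_assoc]
      _ = (g i - e i) * (jm (g - e) Xinv i * jm g X i) * g i := by
            rw [s.inv_mul_g hi]; simp only [mul_assoc, one_mul]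
      _ = 1 := by rw [ih (by omega), mul_one, s.inv_mul_g hi]

end System

/-! ### The commutative subalgebra and its finite spanning set. -/

/-- The generators `t j`, `X i` and `X i ⁻¹` of the large commutative subalgebra. -/
def torus {A ι : Type*} [Ring A] (n : ℕ) (t : ι → A) (g e : ℕ → A) (X Xinv : A) : Set A :=
  Set.range t ∪ (jm g X '' Set.Iio n ∪ jm (g - e) Xinv '' Set.Iio n)

namespace System

variable {K A ι : Type*} [Field K] [Ring A] [Algebra K A] {n : ℕ}
    {t : ι → A} {g e : ℕ → A} {X Xinv : A}

theorem torus_comm (s : System K n t g e X Xinv) :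
    ∀ a ∈ torus n t g e X Xinv, ∀ b ∈ torus n t g e X Xinv, a * b = b * a := by
  have key : ∀ a, (∀ j, Commute a (t j)) → (∀ i < n, Commute a (jm g X i)) →
      ∀ b ∈ torus n t g e X Xinv, Commute a b := by
    rintro a ht hx b (⟨j, rfl⟩ | ⟨i, hi, rfl⟩ | ⟨i, hi, rfl⟩)
    · exact ht j
    · exact hx i hi
    · exact commute_of_inverse (hx i hi) (s.jm_mul_inv hi) (s.inv_mul_jm hi)
  rintro a (⟨j, rfl⟩ | ⟨i, hi, rfl⟩ | ⟨i, hi, rfl⟩)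
  · exact key _ (s.t_comm j) fun i hi => s.t_jm i j hi
  · exact key _ (fun j => (s.t_jm i j hi).symm) fun k hk => s.jm_comm hi hk
  · exact key _
      (fun j => (commute_of_inverse (s.t_jm i j hi) (s.jm_mul_inv hi) (s.inv_mul_jm hi)).symm)
      fun k hk => (commute_of_inverse (s.jm_comm hk hi) (s.jm_mul_inv hi) (s.inv_mul_jm hi)).symm

/-- A weak form of the Bernstein relations. The property passes to sums and products, so generators
suffice; there it comes from `X (i+1) = g i * X i * g i` and the quadratic relation. The
coefficients themselves never matter. -/
theorem exists_g_mul_eq_add (s : System K n t g e X Xinv) {i : ℕ} (hi : i + 1 < n) {x : A}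
    (hx : x ∈ Algebra.adjoin K (torus n t g e X Xinv)) :
    ∃ a ∈ Algebra.adjoin K (torus n t g e X Xinv), ∃ b ∈ Algebra.adjoin K (torus n t g e X Xinv),
      g i * x = a * g i + b := by
  have hle : Algebra.adjoin K (Set.range t) ≤ Algebra.adjoin K (torus n t g e X Xinv) :=
    Algebra.adjoin_mono Set.subset_union_left
  have hX : ∀ j < n, jm g X j ∈ Algebra.adjoin K (torus n t g e X Xinv) := fun j hj =>
    Algebra.subset_adjoin (Or.inr (Or.inl ⟨j, hj, rfl⟩))
  have hY : ∀ j < n, jm (g - e) Xinv j ∈ Algebra.adjoin K (torus n t g e X Xinv) := fun j hj =>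
    Algebra.subset_adjoin (Or.inr (Or.inr ⟨j, hj, rfl⟩))
  have he := hle (s.e_mem i hi)
  have hsq := s.g_sq i hi
  have hg1 := s.g_mul_inv hi
  have hg2 := s.inv_mul_g hi
  induction hx using Algebra.adjoin_induction with
  | mem x hx =>
    rcases hx with ⟨j, rfl⟩ | ⟨j, hj, rfl⟩ | ⟨j, hj, rfl⟩
    · obtain ⟨k, hk, -⟩ := s.g_t i j hi
      exact ⟨t k, hle (Algebra.subset_adjoin ⟨k, rfl⟩), 0, zero_mem _, by rw [hk, add_zero]⟩
    · by_cases h1 : j = i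
      · subst h1
        refine ⟨_, hX (j + 1) hi, _, neg_mem (mul_mem (hX (j + 1) hi) he), ?_⟩
        calc g j * jm g X j = g j * jm g X j * (g j * (g j - e j)) := by rw [hg1, mul_one]
          _ = jm g X (j + 1) * (g j - e j) := by simp only [jm, mul_assoc]
          _ = _ := by rw [mul_sub, sub_eq_add_neg]
      by_cases h2 : j = i + 1
      · subst h2
        refine ⟨_, hX i (by omega), _, mul_mem he (hX (i + 1) hi), ?_⟩
        calc g i * jm g X (i + 1) = (g i * g i) * jm g X i * g i := by simp only [jm, mul_assoc]
          _ = _ := by rw [hsq]; simp only [jm, add_mul, one_mul, mul_assoc]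
      · exact ⟨_, hX j hj, 0, zero_mem _, by rw [add_zero, (s.g_jm j hj hi h1 h2).eq]⟩
    · by_cases h1 : j = i
      · subst h1
        refine ⟨_, hY (j + 1) hi, _, mul_mem he (hY j hj), ?_⟩
        have h3 : jm (g - e) Xinv j = g j * jm (g - e) Xinv (j + 1) * g j := by
          simp only [jm, Pi.sub_apply]
          rw [← mul_assoc, ← mul_assoc, hg1, one_mul, mul_assoc, hg2, mul_one]
        calc g j * jm (g - e) Xinv j
            = (g j * g j) * jm (g - e) Xinv (j + 1) * g j := by
              conv_lhs => rw [h3]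
              simp only [mul_assoc]
          _ = jm (g - e) Xinv (j + 1) * g j + e j * (g j * jm (g - e) Xinv (j + 1) * g j) := by
              rw [hsq]; simp only [add_mul, one_mul, mul_assoc]
          _ = _ := by rw [← h3]
      by_cases h2 : j = i + 1
      · subst h2
        refine ⟨_, hY i (by omega), _, neg_mem (mul_mem (hY i (by omega)) he), ?_⟩
        simp only [jm, Pi.sub_apply]
        rw [← mul_assoc, ← mul_assoc, hg1, one_mul, mul_sub, sub_eq_add_neg]
      · exact ⟨_, hY j hj, 0, zero_mem _, by
          rw [add_zero, (commute_of_inverse (s.g_jm j hj hi h1 h2) (s.jm_mul_inv hj)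
            (s.inv_mul_jm hj)).eq]⟩
  | algebraMap r =>
    exact ⟨_, Subalgebra.algebraMap_mem _ r, 0, zero_mem _, by
      rw [add_zero, Algebra.commutes r (g i)]⟩
  | add x y _ _ hx hy =>
    obtain ⟨a, ha, b, hb, hx⟩ := hx
    obtain ⟨c, hc, d, hd, hy⟩ := hy
    exact ⟨a + c, add_mem ha hc, b + d, add_mem hb hd, by
      rw [mul_add, add_mul, hx, hy]; abel⟩
  | mul x y _ hy' hx hy =>
    obtain ⟨a, ha, b, hb, hx⟩ := hx
    obtain ⟨c, hc, d, hd, hy⟩ := hy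
    exact ⟨a * c, mul_mem ha hc, a * d + b * y, add_mem (mul_mem ha hd) (mul_mem hb hy'), by
      rw [← mul_assoc, hx, add_mul, mul_assoc, hy, mul_add, mul_assoc, add_assoc]⟩

/-- The normal form words span over the large commutative subalgebra. -/
theorem leftSpan_words_eq_top (s : System K n t g e X Xinv)
    (hgen : Algebra.adjoin K (torus n t g e X Xinv ∪ g '' {i | i + 1 < n}) = ⊤) :
    leftSpan (Algebra.adjoin K (torus n t g e X Xinv) : Set A) (words g n) = ⊤ := by
  have hP : ∀ x ∈ Algebra.adjoin K (torus n t g e X Xinv), ∀ u ∈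
      leftSpan (Algebra.adjoin K (torus n t g e X Xinv) : Set A) (words g n),
      x * u ∈ leftSpan (Algebra.adjoin K (torus n t g e X Xinv) : Set A) (words g n) :=
    fun x hx u hu => mul_mem_of_mem_leftSpan (fun z hz f hf => by
      rw [← mul_assoc]; exact mul_mem_leftSpan (mul_mem hx hz) hf) hu
  have hle : leftSpan (Algebra.adjoin K (Set.range t) : Set A) (words g n) ≤
      leftSpan (Algebra.adjoin K (torus n t g e X Xinv) : Set A) (words g n) := by
    refine AddSubgroup.closure_mono ?_
    rintro _ ⟨x, hx, f, hf, rfl⟩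
    exact ⟨x, Algebra.adjoin_mono Set.subset_union_left hx, f, hf, rfl⟩
  have hone : ∀ f ∈ words g n,
      f ∈ leftSpan (Algebra.adjoin K (Set.range t) : Set A) (words g n) := fun f hf => by
    simpa using mul_mem_leftSpan (one_mem (Algebra.adjoin K (Set.range t))) hf
  -- The span is a left ideal; as it contains `1`, it is everything.
  have hall : ∀ a ∈ Algebra.adjoin K (torus n t g e X Xinv ∪ g '' {i | i + 1 < n}), ∀ u ∈
      leftSpan (Algebra.adjoin K (torus n t g e X Xinv) : Set A) (words g n),
      a * u ∈ leftSpan (Algebra.adjoin K (torus n t g e X Xinv) : Set A) (words g n) := by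
    intro a ha
    induction ha using Algebra.adjoin_induction with
    | mem a ha =>
      rcases ha with ha | ⟨i, hi, rfl⟩
      · exact hP a (Algebra.subset_adjoin ha)
      · refine fun u hu => mul_mem_of_mem_leftSpan (fun x hx f hf => ?_) hu
        obtain ⟨a, ha, b, hb, h⟩ := s.exists_g_mul_eq_add hi hx
        rw [← mul_assoc, h, add_mul, mul_assoc]
        exact add_mem (hP a ha _ (hle (s.g_mul_mem le_rfl hi (hone f hf))))
          (hP b hb _ (hle (hone f hf)))
    | algebraMap r => exact hP _ (Subalgebra.algebraMap_mem _ r)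
    | add x y _ _ hx hy =>
      intro u hu
      rw [add_mul]
      exact add_mem (hx u hu) (hy u hu)
    | mul x y _ _ hx hy =>
      intro u hu
      rw [mul_assoc]
      exact hx _ (hy u hu)
  rw [eq_top_iff]
  rintro a -
  have := hall a (hgen ▸ Algebra.mem_top) 1 (hle (hone 1 (one_mem_words g n)))
  rwa [mul_one] at this

theorem finiteDimensional [Finite ι] (s : System K n t g e X Xinv)
    (hgen : Algebra.adjoin K (torus n t g e X Xinv ∪ g '' {i | i + 1 < n}) = ⊤)
    (M : Type*) [AddCommGroup M] [Module A M] [Module K M] [IsScalarTower K A M]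
    [IsSimpleModule A M] : FiniteDimensional K M := by
  have hmc := Algebra.isMulCommutative_adjoin K s.torus_comm
  let _ : CommRing (Algebra.adjoin K (torus n t g e X Xinv)) :=
    { (inferInstance : Ring (Algebra.adjoin K (torus n t g e X Xinv))) with
      mul_comm := hmc.is_comm.comm }
  have hfin : (torus n t g e X Xinv).Finite :=
    (Set.finite_range t).union (((Set.finite_Iio n).image _).union ((Set.finite_Iio n).image _))
  have : Algebra.FiniteType K (Algebra.adjoin K (torus n t g e X Xinv)) :=
    (Subalgebra.fg_iff_finiteType _).1 ((Subalgebra.fg_def).2 ⟨_, hfin, rfl⟩)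
  refine finiteDimensional_of_isSimpleModule_of_span (P := Algebra.adjoin K (torus n t g e X Xinv))
    (Algebra.adjoin K (torus n t g e X Xinv)).val (finite_words g n) (fun S hS => ?_) (M := M)
  rw [eq_top_iff, ← s.leftSpan_words_eq_top hgen, leftSpan, AddSubgroup.closure_le]
  rintro _ ⟨x, hx, f, hf, rfl⟩
  exact hS ⟨x, hx⟩ f hf

end System

/-! ### The specialized algebra satisfies the abstract relations. -/

section Specialization

variable (r n : ℕ) (K : Type*) [Field K] [Algebra (BaseRing r) K]

/-- The canonical map from the free algebra to the specialized affine Yokonuma-Hecke algebra. -/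
noncomputable def toSpecialized :
    Free r n →ₐ[BaseRing r] SpecializedAffineYokonumaHecke r n K :=
  (Algebra.TensorProduct.includeRight :
    AffineYokonumaHeckeAlgebra r n →ₐ[BaseRing r] SpecializedAffineYokonumaHecke r n K).comp
    (RingQuot.mkAlgHom (BaseRing r) (Rel r n))

variable {r n}

theorem toSpecialized_eq {a b : Free r n} (h : Rel r n a b) :
    toSpecialized r n K a = toSpecialized r n K b := by
  simp only [toSpecialized, AlgHom.comp_apply, RingQuot.mkAlgHom_rel (BaseRing r) h]

theorem adjoin_toSpecialized_eq_top :
    Algebra.adjoin K (Set.range fun x : Gen n =>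
      toSpecialized r n K (FreeAlgebra.ι (BaseRing r) x)) = ⊤ := by
  have hfree : ∀ a : Free r n, toSpecialized r n K a ∈
      Algebra.adjoin K (Set.range fun x : Gen n =>
        toSpecialized r n K (FreeAlgebra.ι (BaseRing r) x)) := by
    intro a
    induction a using FreeAlgebra.induction with
    | grade0 c =>
      rw [AlgHom.commutes, IsScalarTower.algebraMap_apply (BaseRing r) K]
      exact Subalgebra.algebraMap_mem _ _
    | grade1 x => exact Algebra.subset_adjoin ⟨x, rfl⟩
    | mul a b ha hb => rw [map_mul]; exact mul_mem ha hb
    | add a b ha hb => rw [map_add]; exact add_mem ha hb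
  rw [eq_top_iff]
  rintro z -
  induction z using TensorProduct.induction_on with
  | zero => exact zero_mem _
  | tmul k y =>
    obtain ⟨a, rfl⟩ := RingQuot.mkAlgHom_surjective (BaseRing r) (Rel r n) y
    have : k ⊗ₜ[BaseRing r] (RingQuot.mkAlgHom (BaseRing r) (Rel r n) a) =
        k • toSpecialized r n K a := by
      simp [toSpecialized, TensorProduct.smul_tmul']
    rw [this]
    exact Subalgebra.smul_mem _ (hfree a) k
  | add x y hx hy => exact add_mem hx hy

/-- The images of the `t j` in the specialized algebra. -/
noncomputable def tImage (j : Fin n) : SpecializedAffineYokonumaHecke r n K :=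
  toSpecialized r n K (t r j)

/-- The images of the `g i` in the specialized algebra, extended by `1`. -/
noncomputable def gImage (r n : ℕ) (K : Type*) [Field K] [Algebra (BaseRing r) K] (i : ℕ) :
    SpecializedAffineYokonumaHecke r n K :=
  if h : i < n - 1 then toSpecialized r n K (g r ⟨i, h⟩) else 1

/-- The images of the `(q - q⁻¹) • e i` in the specialized algebra, extended by `0`. -/
noncomputable def eImage (r n : ℕ) (K : Type*) [Field K] [Algebra (BaseRing r) K] (i : ℕ) :
    SpecializedAffineYokonumaHecke r n K :=
  if h : i < n - 1 then toSpecialized r n K ((q r - qInv r) • e r ⟨i, h⟩) else 0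

theorem gImage_val (i : Fin (n - 1)) : gImage r n K i = toSpecialized r n K (g r i) := by
  simp [gImage]

theorem eImage_val (i : Fin (n - 1)) :
    eImage r n K i = toSpecialized r n K ((q r - qInv r) • e r i) := by
  simp [eImage]

theorem g_mul_t (i : Fin (n - 1)) (j : Fin n) :
    toSpecialized r n K (g r i) * tImage K j =
      tImage K (Equiv.swap (lo i) (hi i) j) * toSpecialized r n K (g r i) := by
  simp only [tImage, ← map_mul]
  exact toSpecialized_eq K (Rel.g_t i j)

theorem tImage_comm (i j : Fin n) : Commute (tImage (r := r) K i) (tImage K j) := by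
  simp only [tImage, Commute, SemiconjBy, ← map_mul]
  exact toSpecialized_eq K (Rel.t_comm i j)

theorem tImage_pow (j : Fin n) : tImage (r := r) K j ^ r = 1 := by
  simpa [tImage] using toSpecialized_eq K (Rel.t_pow (r := r) j)

theorem toSpecialized_e (i : Fin (n - 1)) : toSpecialized r n K (e r i) =
    rInv r • ∑ s ∈ Finset.range r, tImage K (lo i) ^ s * tImage K (hi i) ^ (r - s) := by
  simp [e, tImage]

/-- Conjugation by `g i` exchanges the two `t`'s in `e i`, and `s ↦ r - s` restores the sum. This is
what makes `g i - e i` a two-sided inverse in `System`. -/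
theorem g_mul_e (i : Fin (n - 1)) :
    toSpecialized r n K (g r i) * toSpecialized r n K (e r i) =
      toSpecialized r n K (e r i) * toSpecialized r n K (g r i) := by
  have hlo : SemiconjBy (toSpecialized r n K (g r i)) (tImage K (lo i)) (tImage K (hi i)) := by
    simpa [SemiconjBy] using g_mul_t K i (lo i)
  have hhi : SemiconjBy (toSpecialized r n K (g r i)) (tImage K (hi i)) (tImage K (lo i)) := by
    simpa [SemiconjBy] using g_mul_t K i (hi i)
  rw [toSpecialized_e, mul_smul_comm, smul_mul_assoc, Finset.mul_sum, Finset.sum_mul]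
  congr 1
  have hswap : ∀ s, toSpecialized r n K (g r i) *
      (tImage K (lo i) ^ s * tImage K (hi i) ^ (r - s)) =
      (tImage K (hi i) ^ s * tImage K (lo i) ^ (r - s)) * toSpecialized r n K (g r i) := fun s =>
    ((hlo.pow_right s).mul_right (hhi.pow_right (r - s))).eq
  simp only [hswap, ← Finset.sum_mul]
  congr 1
  have hc : ∀ a b : ℕ, tImage (r := r) K (hi i) ^ a * tImage K (lo i) ^ b =
      tImage K (lo i) ^ b * tImage K (hi i) ^ a :=
    fun a b => ((tImage_comm K (hi i) (lo i)).pow_pow a b).eq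
  simp only [hc]
  -- The reflection `s ↦ r - s` preserves `{0, …, r}` but not `{0, …, r-1}`, so the term `s = r` is
  -- added to both sums; it equals `1` in each because `t ^ r = 1`.
  have hrange := Finset.sum_range_succ
    (fun s => tImage (r := r) K (lo i) ^ s * tImage K (hi i) ^ (r - s)) r
  have hrange' := Finset.sum_range_succ
    (fun s => tImage (r := r) K (lo i) ^ (r - s) * tImage K (hi i) ^ s) r
  have hrefl := Finset.sum_range_reflect
    (fun s => tImage (r := r) K (lo i) ^ s * tImage K (hi i) ^ (r - s)) (r + 1)
  have hcongr : ∑ j ∈ Finset.range (r + 1), tImage (r := r) K (lo i) ^ (r + 1 - 1 - j) *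
      tImage K (hi i) ^ (r - (r + 1 - 1 - j)) =
      ∑ s ∈ Finset.range (r + 1), tImage K (lo i) ^ (r - s) * tImage K (hi i) ^ s := by
    refine Finset.sum_congr rfl fun s hs => ?_
    rw [Finset.mem_range] at hs
    rw [show r + 1 - 1 - s = r - s by omega, show r - (r - s) = s by omega]
  rw [hcongr, hrange, hrange'] at hrefl
  simpa [tImage_pow] using hrefl

theorem system (r n : ℕ) (K : Type*) [Field K] [Algebra (BaseRing r) K] :
    System K n (tImage (r := r) (n := n) K) (gImage r n K) (eImage r n K)
      (toSpecialized r n K (X r n)) (toSpecialized r n K (Xinv r n)) where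
  g_comm i j hij hj := by
    lift i to Fin (n - 1) using by omega
    lift j to Fin (n - 1) using by omega
    simp only [gImage_val, Commute, SemiconjBy, ← map_mul]
    refine toSpecialized_eq K (Rel.g_comm i j ?_)
    rw [abs_sub_comm]
    exact le_abs.2 (Or.inl (by omega))
  braid i hi := by
    have h1 := gImage_val (r := r) K (⟨i, by omega⟩ : Fin (n - 1))
    have h2 := gImage_val (r := r) K (⟨i + 1, by omega⟩ : Fin (n - 1))
    simp only at h1 h2
    rw [h1, h2]
    simp only [← map_mul]
    exact toSpecialized_eq K (Rel.g_braid _ _ rfl)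
  t_comm := tImage_comm K
  g_t i j hi := by
    lift i to Fin (n - 1) using by omega
    refine ⟨Equiv.swap (lo i) (AffineYokonumaHecke.hi i) j, ?_, ?_⟩
    · rw [gImage_val, g_mul_t]
    · rw [gImage_val, g_mul_t, Equiv.swap_apply_self]
  e_mem i hi := by
    lift i to Fin (n - 1) using by omega
    rw [eImage_val, map_smul, toSpecialized_e, ← algebraMap_smul K, ← algebraMap_smul K (rInv r)]
    have ht : ∀ j, tImage K j ∈ Algebra.adjoin K (Set.range (tImage (r := r) (n := n) K)) :=
      fun j => Algebra.subset_adjoin ⟨j, rfl⟩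
    exact Subalgebra.smul_mem _ (Subalgebra.smul_mem _ (sum_mem fun s _ =>
      mul_mem (pow_mem (ht _) _) (pow_mem (ht _) _)) _) _
  g_sq i hi := by
    lift i to Fin (n - 1) using by omega
    have := toSpecialized_eq K (Rel.g_sq (r := r) i)
    rw [gImage_val, eImage_val, ← map_mul, ← map_mul, ← pow_two, this, map_add, map_one,
      smul_mul_assoc]
  g_e i hi := by
    lift i to Fin (n - 1) using by omega
    rw [gImage_val, eImage_val, map_smul, mul_smul_comm, g_mul_e, smul_mul_assoc]
  X_Xinv := by
    rw [← map_mul, toSpecialized_eq K Rel.X_Xinv, map_one]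
  Xinv_X := by
    rw [← map_mul, toSpecialized_eq K Rel.Xinv_X, map_one]
  g_X_g_X hn := by
    have h := gImage_val (r := r) K (⟨0, by omega⟩ : Fin (n - 1))
    simp only at h
    rw [h]
    simp only [← map_mul]
    exact toSpecialized_eq K (Rel.g_X_g_X _ rfl)
  g_X i hi hn := by
    lift i to Fin (n - 1) using by omega
    simp only [gImage_val, Commute, SemiconjBy, ← map_mul]
    exact toSpecialized_eq K (Rel.g_X i (by omega))
  t_X j := by
    simp only [tImage, Commute, SemiconjBy, ← map_mul]
    exact toSpecialized_eq K (Rel.t_X j)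

end Specialization

theorem adjoin_torus_eq_top (r n : ℕ) (hn : 1 ≤ n) (K : Type*) [Field K]
    [Algebra (BaseRing r) K] :
    Algebra.adjoin K (torus n (tImage (r := r) (n := n) K) (gImage r n K) (eImage r n K)
      (toSpecialized r n K (X r n)) (toSpecialized r n K (Xinv r n)) ∪
      gImage r n K '' {i | i + 1 < n}) = ⊤ := by
  rw [eq_top_iff, ← adjoin_toSpecialized_eq_top]
  refine Algebra.adjoin_mono ?_
  rintro _ ⟨x, rfl⟩
  cases x with
  | t j => exact Or.inl (Or.inl ⟨j, rfl⟩)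
  | g i => exact Or.inr ⟨i, show i.val + 1 < n by omega, gImage_val K i⟩
  -- `X` is the Jucys-Murphy element of index `0`, an admissible index because `1 ≤ n`.
  | X => exact Or.inl (Or.inr (Or.inl ⟨0, hn, rfl⟩))
  | Xinv => exact Or.inl (Or.inr (Or.inr ⟨0, hn, rfl⟩))

end AffineYokonumaHecke

theorem corollary2p6 {𝕂 : Type*} [Field 𝕂] [IsAlgClosed 𝕂] (p : ℕ) [CharP 𝕂 p]
    (r n : ℕ) (hr : 1 ≤ r) (hn : 1 ≤ n) (hpr : ¬ p ∣ r) (q : 𝕂ˣ)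
    [Algebra (AffineYokonumaHecke.BaseRing r) 𝕂]
    (hq : algebraMap (AffineYokonumaHecke.BaseRing r) 𝕂 (AffineYokonumaHecke.q r) = (q : 𝕂))
    (M : Type*) [AddCommGroup M] [Module (SpecializedAffineYokonumaHecke r n 𝕂) M]
    [Module 𝕂 M] [IsScalarTower 𝕂 (SpecializedAffineYokonumaHecke r n 𝕂) M]
    [IsSimpleModule (SpecializedAffineYokonumaHecke r n 𝕂) M] :
    FiniteDimensional 𝕂 M := by
  exact (AffineYokonumaHecke.system r n 𝕂).finiteDimensional
    (AffineYokonumaHecke.adjoin_torus_eq_top r n hn 𝕂) M
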